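/- Let $G=(V,E)$ be a finite directed graph with edge capacities $c_{ij}\in\mathbb R$ and unit flow costs $f_{ij}\in\mathbb R$ ($(i,j)\in E$), let $S\subseteq V$ be the set of sources (of any size $n$), with unit storage costs $d_i\ge 0$ ($i\in S$), let $T\subseteq V$ be a nonempty set of terminals, and let $h\in\mathbb R$ (the joint entropy of the sources). Let $G^*=(V^*,E^*)$ be $G$ together with a new node $s^*$ and an edge $(s^*,i)$ of infinite capacity for each $i\in S$. For $t\in T$, $i\in V^*$ put $\sigma^{(t)}_i=h$ if $i=s^*$, $-h$ if $i=t$, and $0$ otherwise. Let $\mathcal A$ be the set of the $2^n-1$ nonempty subsets of $S$; $A\in\mathcal A$ stands for the atom $\bigcap_{i\in A}\widetilde X_i\cap\bigcap_{i\in S\setminus A}\widetilde X_i^c$. For real values $\mu=(\mu(A))_{A\in\mathcal A}$, $i,j\in S$ and $U,K\subseteq S$ write $$H_\mu(X_i)=\sum_{A\ni i}\mu(A),\qquad H_\mu(X_U\mid X_{S\setminus U})=\sum_{\emptyset\ne A\subseteq U}\mu(A),\qquad I_\mu(X_i;X_j\mid X_K)=\sum_{A\ni i,j,\ A\cap K=\emptyset}\mu(A),\qquad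 D(\mu)=\sum_{A\in\mathcal A}\Big(\sum_{i\in A}d_i\Big)\mu(A).$$ Consider the following linear programs. * CODED-MIN-COST: minimize $\sum_{(i,j)\in E}f_{ij}z_{ij}+\sum_{i\in S}d_iz_{s^*i}$ over $x^{(t)}_{ij},z_{ij}$ ($(i,j)\in E^*$, $t\in T$) subject to $0\le x^{(t)}_{ij}\le z_{ij}$ on $E^*$, $z_{ij}\le c_{ij}$ on $E$, and $\sum_{j:(i,j)\in E^*}x^{(t)}_{ij}-\sum_{j:(j,i)\in E^*}x^{(t)}_{ji}=\sigma^{(t)}_i$ for all $i\in V^*$, $t\in T$. * ATOM-CODED-MIN-COST: the same objective and constraints, with further variables $R^{(t)}_i$ and $\mu(A)$ of arbitrary sign ($i\in S$, $t\in T$, $A\in\mathcal A$) and further constraints $x^{(t)}_{s^*i}\ge R^{(t)}_i$; $\sum_{i\in U}R^{(t)}_i\ge H_\mu(X_U\mid X_{S\setminus U})$ for all $U\subseteq S$, $t\in T$ (Slepian–Wolf); $z_{s^*i}=H_\mu(X_i)$ for $i\in S$; $\sum_{A\in\mathcal A}\mu(A)=h$; and the elemental inequalities $H_\mu(X_i\mid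 X_{S\setminus\{i\}})\ge0$ ($i\in S$) and $I_\mu(X_i;X_j\mid X_K)\ge0$ ($i\ne j$ in $S$, $K\subseteq S\setminus\{i,j\}$). * SUBSET-MIN-COST: minimize $\sum_{(i,j)\in E}f_{ij}z_{ij}+D(\mu)$ over the same variables and under the same constraints as in ATOM-CODED-MIN-COST, except that the elemental inequalities are replaced by $\mu(A)\ge0$ for all $A\in\mathcal A$. * The gap LP for given atom values $\mu_1$: minimize $D(\mu)-D(\mu_1)$ over $\mu$ subject to $H_\mu(X_U\mid X_{S\setminus U})\le H_{\mu_1}(X_U\mid X_{S\setminus U})$ for all $U\subseteq S$, $\mu(A)\ge0$ for all $A\in\mathcal A$, and $\sum_{A\in\mathcal A}\mu(A)=h$. Then: 1. ATOM-CODED-MIN-COST and CODED-MIN-COST have the same optimal value (which is $+\infty$ if and only if there is no feasible point); if CODED-MIN-COST is feasible, both attain it. 2. Let $(x_1,z_1,R_1,\mu_1)$ be any optimal solution of ATOM-CODED-MIN-COST. The gap LP for $\mu_1$ has an optimal solution. For every feasible $\mu$ of the gap LP, the same flows $x_1$ and rates $R_1$, the values $z_{ij}=(z_1)_{ij}$ on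 $E$ and $z_{s^*i}=H_\mu(X_i)$, and the atom values $\mu$ form a feasible solution of SUBSET-MIN-COST, whose cost exceeds that of $(x_1,z_1,R_1,\mu_1)$ by exactly the value of the gap LP objective at $\mu$. Moreover SUBSET-MIN-COST has an optimal solution, and (optimal value of SUBSET-MIN-COST) $-$ (optimal value of CODED-MIN-COST) $\le$ (optimal value of the gap LP for $\mu_1$). -/

import Mathlib

/-- A minimization problem with real objective over a space of points. -/
structure MinProblem (α : Type*) where
  /-- The set of feasible points. -/
  feasible : Set α
  /-- The objective function. -/
  cost : α → ℝ

namespace MinProblem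

variable {α : Type*}

/-- The optimal value, as an extended real number (it is `⊤` iff the problem is infeasible). -/
noncomputable def value (P : MinProblem α) : EReal :=
  ⨅ p ∈ P.feasible, (P.cost p : EReal)

/-- `p` is an optimal solution: feasible, and of least cost among the feasible points. -/
def IsOptimal (P : MinProblem α) (p : α) : Prop :=
  p ∈ P.feasible ∧ ∀ q ∈ P.feasible, P.cost p ≤ P.cost q

end MinProblem

/-! ### Atoms of the field generated by the sets attached to the sources

The nonempty atom `⋂_{i ∈ A} X̃ᵢ ∩ ⋂_{i ∈ S \ A} X̃ᵢᶜ` of the field generated by the sets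
`X̃ᵢ`, `i ∈ S`, is represented by the nonempty set `A ⊆ S`. A member of the field is represented
by the set of nonempty atoms of which it is the union. -/

section Atoms

variable {V : Type*} [DecidableEq V]

/-- The set `𝒜` of the `2 ^ |S| - 1` nonempty atoms. -/
def atoms (S : Finset V) : Finset (Finset V) := S.powerset.erase ∅

/-- The set `X̃ᵢ`: the union of the atoms `A` in which `X̃ᵢ` occurs uncomplemented. -/
def sourceSet (S : Finset V) (i : V) : Finset (Finset V) := (atoms S).filter (fun A => i ∈ A)

/-- `X̃_U = ⋃_{i ∈ U} X̃ᵢ`. -/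
def unionSet (S U : Finset V) : Finset (Finset V) := U.biUnion (sourceSet S)

/-- The value, on a member `B` of the field, of the signed measure with atom values `μ`. -/
def signedMeas (μ : Finset V → ℝ) (B : Finset (Finset V)) : ℝ := ∑ A ∈ B, μ A

/-- `H(X_U) = μ*(X̃_U)`. -/
def entropy (S : Finset V) (μ : Finset V → ℝ) (U : Finset V) : ℝ :=
  signedMeas μ (unionSet S U)

/-- `H(X_U | X_{S \ U})`: the sum of `μ*(A)` over the atoms `A ⊄ X̃_{S \ U}`. -/
def condEntropy (S : Finset V) (μ : Finset V → ℝ) (U : Finset V) : ℝ :=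
  signedMeas μ (atoms S \ unionSet S (S \ U))

/-- `I(X_i ; X_j | X_K)`: the sum of `μ*(A)` over the atoms `A ⊂ X̃ᵢ`, `A ⊂ X̃ⱼ`, `A ⊄ X̃_K`. -/
def condMutualInfo (S : Finset V) (μ : Finset V → ℝ) (i j : V) (K : Finset V) : ℝ :=
  signedMeas μ ((sourceSet S i ∩ sourceSet S j) \ unionSet S K)

/-- The elemental (Shannon) inequalities. -/
def ElementalInequalities (S : Finset V) (μ : Finset V → ℝ) : Prop :=
  (∀ i ∈ S, 0 ≤ condEntropy S μ {i}) ∧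
  ∀ i ∈ S, ∀ j ∈ S, i ≠ j → ∀ K ⊆ S \ {i, j}, 0 ≤ condMutualInfo S μ i j K

/-- The Slepian-Wolf region of the sources. -/
def slepianWolf (S : Finset V) (μ : Finset V → ℝ) : Set (V → ℝ) :=
  {R | ∀ U ⊆ S, condEntropy S μ U ≤ ∑ i ∈ U, R i}

end Atoms

/-- The data of the content distribution problem on a directed graph with vertex set `V`. -/
structure MulticastInstance (V : Type*) where
  /-- The edges. -/
  E : Finset (V × V)
  /-- The source nodes. -/
  S : Finset V
  /-- The terminals. -/
  T : Finset V
  /-- The edge capacities. -/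
  c : V × V → ℝ
  /-- The cost per unit of flow on an edge. -/
  f : V × V → ℝ
  /-- The cost per unit of information stored at a source node. -/
  d : V → ℝ
  /-- The joint entropy `H(X_1, …, X_n)` of the original source. -/
  h : ℝ

/-- The flow variables: `x t e` is the flow for terminal `t` on the edge `e` of the augmented
graph, `z e` the capacity used on `e`. The vertex `none` is the virtual super node `s*`. -/
structure FlowPoint (V : Type*) where
  /-- `x t (i, j)` is `x_{ij}^{(t)}`. -/
  x : V → Option V × Option V → ℝ
  /-- `z (i, j)` is `z_{ij}`. -/
  z : Option V × Option V → ℝ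

/-- The flow variables together with the rates `R t i` and the atom measures `μ A`. -/
structure AtomFlowPoint (V : Type*) extends FlowPoint V where
  /-- `R t i` is the rate from source `i` to terminal `t`. -/
  R : V → V → ℝ
  /-- `μ A` is the measure `μ*(A)` of the atom `A`. -/
  μ : Finset V → ℝ

namespace MulticastInstance

variable {V : Type*} [DecidableEq V] (N : MulticastInstance V)

/-- The edges of the augmented graph `G*`: those of `G`, and `(s*, i)` for each source `i`. -/
def Estar : Finset (Option V × Option V) :=
  N.E.image (fun e => (some e.1, some e.2)) ∪ N.S.image (fun i => (none, some i))

/-- The capacities of `G*`; those of the virtual edges are infinite. -/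
noncomputable def cstar : Option V × Option V → EReal
  | (some i, some j) => (N.c (i, j) : EReal)
  | _ => ⊤

/-- The net outflow `σ_i^{(t)}` required at the vertex `i` of `G*`. -/
def sigma (t : V) : Option V → ℝ
  | none => N.h
  | some i => if i = t then -N.h else 0

/-- `0 ≤ x ≤ z ≤ c*` on the edges of `G*`, and flow balance at all vertices of `G*`. -/
def FlowConstraints (p : FlowPoint V) : Prop :=
  (∀ t ∈ N.T, ∀ e ∈ N.Estar, 0 ≤ p.x t e ∧ p.x t e ≤ p.z e ∧ (p.z e : EReal) ≤ N.cstar e) ∧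
  ∀ t ∈ N.T, ∀ i : Option V,
    (∑ e ∈ N.Estar.filter (fun e => e.1 = i), p.x t e) -
      (∑ e ∈ N.Estar.filter (fun e => e.2 = i), p.x t e) = N.sigma t i

/-- `∑_{(i,j) ∈ E} f_{ij} z_{ij}`. -/
def edgeCost (p : FlowPoint V) : ℝ := ∑ e ∈ N.E, N.f e * p.z (some e.1, some e.2)

/-- `∑_{i ∈ S} d_i z_{s* i}`. -/
def storageCost (p : FlowPoint V) : ℝ := ∑ i ∈ N.S, N.d i * p.z (none, some i)

/-- `∑_{A ∈ 𝒜} (∑_{i ∈ S, A ⊂ X̃ᵢ} d_i) μ*(A)`. -/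
def atomStorageCost (μ : Finset V → ℝ) : ℝ :=
  ∑ A ∈ atoms N.S, (∑ i ∈ N.S.filter (fun i => A ∈ sourceSet N.S i), N.d i) * μ A

/-- The constraints shared by the coded and the subset problem with atom measures as variables:
network flow, rates supported by the flow and in the Slepian-Wolf region, storage `H(X_i)` at
source `i`, and joint entropy `h`. -/
def AtomConstraints (p : AtomFlowPoint V) : Prop :=
  N.FlowConstraints p.toFlowPoint ∧
  (∀ t ∈ N.T, ∀ i ∈ N.S, p.R t i ≤ p.x t (none, some i)) ∧
  (∀ t ∈ N.T, p.R t ∈ slepianWolf N.S p.μ) ∧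
  (∀ i ∈ N.S, p.z (none, some i) = entropy N.S p.μ {i}) ∧
  N.h = signedMeas p.μ (atoms N.S)

/-- CODED-MIN-COST. -/
def coded : MinProblem (FlowPoint V) where
  feasible := {p | N.FlowConstraints p}
  cost p := N.edgeCost p + N.storageCost p

/-- ATOM-CODED-MIN-COST. -/
def atomCoded : MinProblem (AtomFlowPoint V) where
  feasible := {p | N.AtomConstraints p ∧ ElementalInequalities N.S p.μ}
  cost p := N.edgeCost p.toFlowPoint + N.storageCost p.toFlowPoint

/-- SUBSET-MIN-COST. -/
def subset : MinProblem (AtomFlowPoint V) where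
  feasible := {p | N.AtomConstraints p ∧ ∀ A ∈ atoms N.S, 0 ≤ p.μ A}
  cost p := N.edgeCost p.toFlowPoint + N.atomStorageCost p.μ

/-- The gap LP for given atom values `μ₁`. -/
def gap (μ₁ : Finset V → ℝ) : MinProblem (Finset V → ℝ) where
  feasible := {μ | (∀ U ⊆ N.S, condEntropy N.S μ U ≤ condEntropy N.S μ₁ U) ∧
    (∀ A ∈ atoms N.S, 0 ≤ μ A) ∧ signedMeas μ (atoms N.S) = N.h}
  cost μ := N.atomStorageCost μ - N.atomStorageCost μ₁

/-- Replace the atom values by `μ` and the storage `z_{s* i}` by the resulting `H(X_i)`; all the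
flows, the rates, and `z` on the edges of `G` are kept. -/
def withAtoms (p : AtomFlowPoint V) (μ : Finset V → ℝ) : AtomFlowPoint V where
  x := p.x
  z := fun e => match e with
    | (none, some i) => entropy N.S μ {i}
    | e => p.z e
  R := p.R
  μ := μ

end MulticastInstance

/-! ### Atom values, conditional entropies and Möbius inversion -/

section Atoms

variable {V : Type*} [DecidableEq V]

/-! Forgetting rates and atom values turns an atom-coded point into a coded one of the same cost.
Conversely, the flows out of `s*` sum to `h`, so storage can be capped at `h`, which costs no more
since `d ≥ 0`. The capped storages `y` are the singleton values of the polymatroid `W ↦ min h (∑ i ∈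
W, y i)`. Möbius inversion gives its atom values, submodularity the elemental inequalities, and the
flows out of `s*` satisfy Slepian–Wolf as rates (`toAtomFlowPoint_mem_feasible`).

For the gap LP, smaller conditional entropies only enlarge the Slepian–Wolf region. At `S \ {i}`,
with the total fixed at `h`, they force `H(X_i)` up, so the old flows still fit
(`withAtoms_mem_feasible`). Costs differ by the gap objective because storage cost is a double sum
over sources and atoms (`storageCost_eq_atomStorageCost`). The gap LP is feasible because elemental
inequalities make every `H(X_U | X_{S \ U})` nonnegative (`gap_feasible_nonempty`). Optima exist by
compactness after normalising points. -/

lemma mem_atoms {S A : Finset V} : A ∈ atoms S ↔ A ≠ ∅ ∧ A ⊆ S := by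
  simp [atoms]

lemma mem_unionSet {S U A : Finset V} :
    A ∈ unionSet S U ↔ A ∈ atoms S ∧ ∃ i ∈ U, i ∈ A := by
  simp only [unionSet, sourceSet, Finset.mem_biUnion, Finset.mem_filter]
  tauto

lemma unionSet_singleton (S : Finset V) (i : V) : unionSet S {i} = sourceSet S i := by
  simp [unionSet]

/-- An atom avoids every source outside `U` exactly when it is a subset of `U`. All information
quantities thereby become differences of the one set function `U ↦ signedMeas μ (atoms U)`. -/
lemma condEntropy_eq_signedMeas_atoms {S U : Finset V} (μ : Finset V → ℝ) (hU : U ⊆ S) :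
    condEntropy S μ U = signedMeas μ (atoms U) := by
  unfold condEntropy
  congr 1
  ext A
  simp only [Finset.mem_sdiff, mem_unionSet, mem_atoms]
  constructor
  · rintro ⟨⟨hA, hS⟩, h⟩
    refine ⟨hA, fun i hi => ?_⟩
    by_contra hiU
    exact h ⟨⟨hA, hS⟩, i, ⟨hS hi, hiU⟩, hi⟩
  · rintro ⟨hA, h⟩
    exact ⟨⟨hA, h.trans hU⟩, fun ⟨_, i, hi, hiA⟩ => hi.2 (h hiA)⟩

lemma signedMeas_sourceSet (μ : Finset V → ℝ) (W : Finset V) (i : V) :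
    signedMeas μ (sourceSet W i) = signedMeas μ (atoms W) - signedMeas μ (atoms (W.erase i)) := by
  have h : atoms (W.erase i) = (atoms W).filter (fun A => ¬ i ∈ A) := by
    ext A
    simp only [mem_atoms, Finset.mem_filter, Finset.subset_erase]
    tauto
  rw [h, eq_sub_iff_add_eq]
  exact Finset.sum_filter_add_sum_filter_not _ _ _

lemma entropy_singleton (S : Finset V) (μ : Finset V → ℝ) (i : V) :
    entropy S μ {i} = signedMeas μ (atoms S) - signedMeas μ (atoms (S.erase i)) := by
  rw [entropy, unionSet_singleton, signedMeas_sourceSet]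

/-- The atoms avoiding `K` are the atoms of `S \ K`; requiring `j` as well is then a difference. -/
lemma condMutualInfo_eq {S : Finset V} (μ : Finset V → ℝ) (i j : V) (K : Finset V) :
    condMutualInfo S μ i j K =
      signedMeas μ (sourceSet (S \ K) i) - signedMeas μ (sourceSet ((S \ K).erase j) i) := by
  have h₁ : (sourceSet S i ∩ sourceSet S j) \ unionSet S K =
      (sourceSet (S \ K) i).filter (fun A => j ∈ A) := by
    ext A
    simp only [Finset.mem_sdiff, Finset.mem_inter, sourceSet, mem_unionSet, mem_atoms,
      Finset.mem_filter, Finset.subset_sdiff, Finset.disjoint_right]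
    constructor
    · rintro ⟨⟨⟨⟨h₁, h₂⟩, h₃⟩, -, h₄⟩, h⟩
      exact ⟨⟨⟨h₁, h₂, fun k hk hA => h ⟨⟨h₁, h₂⟩, k, hk, hA⟩⟩, h₃⟩, h₄⟩
    · rintro ⟨⟨⟨h₁, h₂, h⟩, h₃⟩, h₄⟩
      exact ⟨⟨⟨⟨h₁, h₂⟩, h₃⟩, ⟨h₁, h₂⟩, h₄⟩, fun ⟨_, k, hk, hA⟩ => h hk hA⟩
  have h₂ : sourceSet ((S \ K).erase j) i =
      (sourceSet (S \ K) i).filter (fun A => ¬ j ∈ A) := by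
    ext A
    simp only [sourceSet, mem_atoms, Finset.mem_filter, Finset.subset_erase]
    tauto
  rw [condMutualInfo, h₁, h₂, eq_sub_iff_add_eq]
  exact Finset.sum_filter_add_sum_filter_not _ _ _

/-- The quantity is `H(X_i | X_K)` with `K` the complement of `insert i W`. For empty `W` it is an
elemental inequality, and each new element of `W` adds a conditional mutual information. -/
lemma signedMeas_sourceSet_nonneg {S : Finset V} {μ : Finset V → ℝ}
    (hμ : ElementalInequalities S μ) {i : V} (hi : i ∈ S) {W : Finset V} (hW : W ⊆ S)
    (hiW : i ∉ W) : 0 ≤ signedMeas μ (sourceSet (insert i W) i) := by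
  induction W using Finset.induction_on with
  | empty =>
    have h := hμ.1 i hi
    rw [condEntropy_eq_signedMeas_atoms μ (by simpa using hi)] at h
    rw [signedMeas_sourceSet]
    simpa [atoms, signedMeas] using h
  | insert j W hj ih =>
    rw [Finset.insert_subset_iff] at hW
    rw [Finset.mem_insert, not_or] at hiW
    have h := hμ.2 i hi j hW.1 hiW.1 (S \ insert i (insert j W)) (by
      apply Finset.sdiff_subset_sdiff le_rfl
      intro k
      simp only [Finset.mem_insert, Finset.mem_singleton]
      tauto)
    have hsub : insert i (insert j W) ⊆ S := by
      simp [Finset.insert_subset_iff, hi, hW.1, hW.2]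
    have he : (insert i (insert j W)).erase j = insert i W := by
      ext k
      simp only [Finset.mem_insert, Finset.mem_erase]
      constructor
      · tauto
      · rintro (rfl | h)
        · exact ⟨hiW.1, Or.inl rfl⟩
        · exact ⟨fun hk => hj (hk ▸ h), by tauto⟩
    rw [condMutualInfo_eq, Finset.sdiff_sdiff_eq_self hsub, he] at h
    linarith [ih hW.2 hiW.2]

/-- Chain rule: adding one source at a time adds the nonnegative terms of
`signedMeas_sourceSet_nonneg`. -/
lemma ElementalInequalities.condEntropy_nonneg {S : Finset V} {μ : Finset V → ℝ}
    (hμ : ElementalInequalities S μ) {U : Finset V} (hU : U ⊆ S) : 0 ≤ condEntropy S μ U := by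
  rw [condEntropy_eq_signedMeas_atoms μ hU]
  induction U using Finset.induction_on with
  | empty => simp [atoms, signedMeas]
  | insert i W hi ih =>
    rw [Finset.insert_subset_iff] at hU
    have h := signedMeas_sourceSet_nonneg hμ hU.1 hU.2 hi
    rw [signedMeas_sourceSet, Finset.erase_insert hi] at h
    linarith [ih hU.2]

/-- The Möbius inverse of a set function: the atom values whose sums over the nonempty subsets of
`U` are `g U`. -/
noncomputable def atomValues (g : Finset V → ℝ) (A : Finset V) : ℝ :=
  g A - ∑ B ∈ (A.ssubsets.erase ∅).attach, atomValues g B.1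
termination_by A.card
decreasing_by
  exact Finset.card_lt_card (Finset.mem_ssubsets.1 (Finset.mem_of_mem_erase B.2))

lemma signedMeas_atomValues {g : Finset V → ℝ} (hg : g ∅ = 0) (U : Finset V) :
    signedMeas (atomValues g) (atoms U) = g U := by
  rcases eq_or_ne U ∅ with rfl | hU
  · simp [atoms, signedMeas, hg]
  have h : atoms U = insert U (U.ssubsets.erase ∅) := by
    ext A
    simp only [mem_atoms, Finset.mem_insert, Finset.mem_erase, Finset.mem_ssubsets,
      Finset.ssubset_iff_subset_ne]
    constructor
    · tauto
    · rintro (rfl | h)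
      · exact ⟨hU, subset_rfl⟩
      · exact ⟨h.1, h.2.1⟩
  rw [h, signedMeas, Finset.sum_insert (by simp), atomValues, Finset.sum_attach _ (atomValues g)]
  ring

@[fun_prop]
lemma continuous_signedMeas (B : Finset (Finset V)) :
    Continuous (fun μ : Finset V → ℝ => signedMeas μ B) := by
  unfold signedMeas
  fun_prop

lemma signedMeas_congr {μ ν : Finset V → ℝ} {S : Finset V} (h : ∀ A ∈ atoms S, μ A = ν A)
    {B : Finset (Finset V)} (hB : B ⊆ atoms S) : signedMeas μ B = signedMeas ν B :=
  Finset.sum_congr rfl fun A hA => h A (hB hA)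

lemma unionSet_subset (S U : Finset V) : unionSet S U ⊆ atoms S :=
  fun _ hA => (mem_unionSet.1 hA).1

lemma signedMeas_mono {μ : Finset V → ℝ} {S : Finset V} (h : ∀ A ∈ atoms S, 0 ≤ μ A)
    {B : Finset (Finset V)} (hB : B ⊆ atoms S) : signedMeas μ B ≤ signedMeas μ (atoms S) :=
  Finset.sum_le_sum_of_subset_of_nonneg hB fun A hA _ => h A hA

lemma le_signedMeas_atoms {μ : Finset V → ℝ} {S : Finset V} (h : ∀ A ∈ atoms S, 0 ≤ μ A)
    {A : Finset V} (hA : A ∈ atoms S) : μ A ≤ signedMeas μ (atoms S) :=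
  Finset.single_le_sum (f := μ) h hA

end Atoms

/-! ### Attainment and comparison of optimal values -/

namespace MinProblem

/-- The feasible set need not be compact: it suffices that a compact family of feasible points
contains, for each feasible point, one that is no more expensive. -/
lemma exists_isOptimal_of_isCompact {α β : Type*} [TopologicalSpace β] (P : MinProblem α)
    {K : Set β} (hK : IsCompact K) (φ : β → α) (hφ : ∀ k ∈ K, φ k ∈ P.feasible)
    (hc : Continuous fun k => P.cost (φ k))
    (h : ∀ p ∈ P.feasible, ∃ k ∈ K, P.cost (φ k) ≤ P.cost p) (hne : P.feasible.Nonempty) :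
    ∃ p, P.IsOptimal p := by
  obtain ⟨p, hp⟩ := hne
  obtain ⟨k₀, hk₀, -⟩ := h p hp
  obtain ⟨k, hk, hmin⟩ := hK.exists_isMinOn ⟨k₀, hk₀⟩ hc.continuousOn
  refine ⟨φ k, hφ k hk, fun q hq => ?_⟩
  obtain ⟨l, hl, hlq⟩ := h q hq
  exact (hmin hl).trans hlq

lemma value_le_value {α β : Type*} {P : MinProblem α} {Q : MinProblem β}
    (h : ∀ q ∈ Q.feasible, ∃ p ∈ P.feasible, P.cost p ≤ Q.cost q) : P.value ≤ Q.value :=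
  le_iInf₂ fun q hq =>
    let ⟨p, hp, hpq⟩ := h q hq
    (iInf₂_le p hp).trans (EReal.coe_le_coe_iff.2 hpq)

end MinProblem

/-! ### Flows in the augmented graph -/

namespace MulticastInstance

variable {V : Type*} [DecidableEq V] (N : MulticastInstance V)

lemma some_mem_Estar {i j : V} : (some i, some j) ∈ N.Estar ↔ (i, j) ∈ N.E := by
  simp [Estar]

lemma none_mem_Estar {i : V} : ((none, some i) : Option V × Option V) ∈ N.Estar ↔ i ∈ N.S := by
  simp [Estar]

lemma not_mem_Estar_none (o : Option V) : (o, none) ∉ N.Estar := by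
  simp [Estar]

variable {N}

lemma FlowConstraints.sum_source {p : FlowPoint V} (hp : N.FlowConstraints p) {t : V}
    (ht : t ∈ N.T) : ∑ i ∈ N.S, p.x t (none, some i) = N.h := by
  have h := hp.2 t ht none
  have h₁ : N.Estar.filter (fun e => e.1 = none) = N.S.image (fun i => (none, some i)) := by
    ext ⟨a, b⟩
    simp only [Estar, Finset.mem_filter, Finset.mem_union, Finset.mem_image, Prod.mk.injEq]
    constructor
    · rintro ⟨⟨e, -, h, -⟩ | h, rfl⟩
      · simp at h
      · exact h
    · rintro ⟨i, hi, rfl, rfl⟩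
      exact ⟨Or.inr ⟨i, hi, rfl, rfl⟩, rfl⟩
  have h₂ : N.Estar.filter (fun e => e.2 = none) = ∅ := by
    apply Finset.filter_eq_empty_iff.2
    rintro ⟨a, b⟩ he rfl
    exact N.not_mem_Estar_none a he
  rw [h₁, h₂, Finset.sum_image (by simp)] at h
  simpa [sigma] using h

lemma FlowConstraints.source_nonneg {p : FlowPoint V} (hp : N.FlowConstraints p) {t : V}
    (ht : t ∈ N.T) {i : V} (hi : i ∈ N.S) : 0 ≤ p.x t (none, some i) :=
  (hp.1 t ht _ (N.none_mem_Estar.2 hi)).1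

lemma FlowConstraints.source_le {p : FlowPoint V} (hp : N.FlowConstraints p) {t : V}
    (ht : t ∈ N.T) {W : Finset V} (hW : W ⊆ N.S) : ∑ i ∈ W, p.x t (none, some i) ≤ N.h := by
  rw [← hp.sum_source ht]
  exact Finset.sum_le_sum_of_subset_of_nonneg hW fun i hi _ => hp.source_nonneg ht hi

lemma FlowConstraints.h_nonneg {p : FlowPoint V} (hp : N.FlowConstraints p)
    (hT : N.T.Nonempty) : 0 ≤ N.h := by
  obtain ⟨t, ht⟩ := hT
  simpa using hp.source_le ht (Finset.empty_subset _)

lemma FlowConstraints.z_nonneg {p : FlowPoint V} (hp : N.FlowConstraints p)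
    (hT : N.T.Nonempty) {e : Option V × Option V} (he : e ∈ N.Estar) : 0 ≤ p.z e := by
  obtain ⟨t, ht⟩ := hT
  exact (hp.1 t ht e he).1.trans (hp.1 t ht e he).2.1

/-- Replacing the storage values, and all values away from the edges and terminals. -/
lemma FlowConstraints.of_eq {p q : FlowPoint V} (hp : N.FlowConstraints p)
    (hx : ∀ t ∈ N.T, ∀ e ∈ N.Estar, q.x t e = p.x t e)
    (hz : ∀ e ∈ N.E, q.z (some e.1, some e.2) = p.z (some e.1, some e.2))
    (hs : ∀ t ∈ N.T, ∀ i ∈ N.S, p.x t (none, some i) ≤ q.z (none, some i)) :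
    N.FlowConstraints q := by
  refine ⟨fun t ht e he => ?_, fun t ht i => ?_⟩
  · rw [hx t ht e he]
    have h := hp.1 t ht e he
    rcases e with ⟨_ | i, _ | j⟩
    · exact absurd he (N.not_mem_Estar_none _)
    · exact ⟨h.1, hs t ht j (N.none_mem_Estar.1 he), le_top⟩
    · exact absurd he (N.not_mem_Estar_none _)
    · rw [hz (i, j) (N.some_mem_Estar.1 he)]
      exact h
  · rw [← hp.2 t ht i]
    congr 1 <;>
    exact Finset.sum_congr rfl fun e he => hx t ht e (Finset.mem_filter.1 he).1

/-! ### Compactness and optima of the coded problem -/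

variable (N)

lemma edgeCost_congr {p q : FlowPoint V}
    (hz : ∀ e ∈ N.E, q.z (some e.1, some e.2) = p.z (some e.1, some e.2)) :
    N.edgeCost q = N.edgeCost p :=
  Finset.sum_congr rfl fun e he => by rw [hz e he]

/-- The bound on the variables at an edge of `G*` in solutions that store at most `h` at each
source. -/
noncomputable def edgeBound : Option V × Option V → ℝ
  | (some i, some j) => |N.c (i, j)|
  | _ => |N.h|

/-- The flow variables with all entries between `0` and `edgeBound`. -/
def flowBox : Set ((V → Option V × Option V → ℝ) × (Option V × Option V → ℝ)) :=
  (Set.univ.pi fun _ => Set.univ.pi fun e => Set.Icc 0 (N.edgeBound e)) ×ˢ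
    Set.univ.pi fun e => Set.Icc 0 (N.edgeBound e)

lemma isCompact_flowBox : IsCompact N.flowBox :=
  (isCompact_univ_pi fun _ => isCompact_univ_pi fun _ => isCompact_Icc).prod
    (isCompact_univ_pi fun _ => isCompact_Icc)

lemma isClosed_flowConstraints :
    IsClosed {p : (V → Option V × Option V → ℝ) × (Option V × Option V → ℝ) |
      N.FlowConstraints ⟨p.1, p.2⟩} := by
  simp only [FlowConstraints, Set.ofPred_and, Set.ofPred_forall]
  refine .inter (isClosed_iInter fun t => isClosed_iInter fun _ => isClosed_iInter fun e =>
    isClosed_iInter fun _ => .inter ?_ (.inter ?_ ?_))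
    (isClosed_iInter fun t => isClosed_iInter fun _ => isClosed_iInter fun i => ?_)
  · exact isClosed_le (by fun_prop) (by fun_prop)
  · exact isClosed_le (by fun_prop) (by fun_prop)
  · exact isClosed_le (continuous_coe_real_ereal.comp (by fun_prop)) (by fun_prop)
  · exact isClosed_eq (by fun_prop) (by fun_prop)

/-- The flow variables, set to zero away from the edges of `G*` and the terminals. -/
def restrict (p : FlowPoint V) : FlowPoint V where
  x := fun t e => if t ∈ N.T ∧ e ∈ N.Estar then p.x t e else 0
  z := fun e => if e ∈ N.Estar then p.z e else 0

variable {N}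

lemma FlowConstraints.restrict {p : FlowPoint V} (hp : N.FlowConstraints p) :
    N.FlowConstraints (N.restrict p) := by
  refine hp.of_eq (fun t ht e he => ?_) (fun e he => ?_) (fun t ht i hi => ?_)
  · simp [MulticastInstance.restrict, ht, he]
  · simp [MulticastInstance.restrict, N.some_mem_Estar.2 he]
  · simpa [MulticastInstance.restrict, N.none_mem_Estar.2 hi] using
      (hp.1 t ht _ (N.none_mem_Estar.2 hi)).2.1

lemma FlowConstraints.restrict_mem_flowBox {p : FlowPoint V} (hp : N.FlowConstraints p)
    (hT : N.T.Nonempty) (hs : ∀ i ∈ N.S, p.z (none, some i) ≤ N.h) :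
    ((N.restrict p).x, (N.restrict p).z) ∈ N.flowBox := by
  have hB : ∀ e, 0 ≤ N.edgeBound e := by
    rintro ⟨_ | i, _ | j⟩ <;> exact abs_nonneg _
  have hz : ∀ e ∈ N.Estar, p.z e ≤ N.edgeBound e := by
    obtain ⟨t, ht⟩ := hT
    rintro ⟨_ | i, _ | j⟩ he
    · exact absurd he (N.not_mem_Estar_none _)
    · exact (hs j (N.none_mem_Estar.1 he)).trans (le_abs_self _)
    · exact absurd he (N.not_mem_Estar_none _)
    · exact (EReal.coe_le_coe_iff.1 (hp.1 t ht _ he).2.2).trans (le_abs_self _)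
  refine Set.mk_mem_prod (fun t _ e _ => ?_) fun e _ => ?_
  · simp only [MulticastInstance.restrict]
    split_ifs with h
    · have := hp.1 t h.1 e h.2
      exact ⟨this.1, this.2.1.trans (hz e h.2)⟩
    · exact ⟨le_rfl, hB e⟩
  · simp only [MulticastInstance.restrict]
    split_ifs with h
    · exact ⟨hp.z_nonneg hT h, hz e h⟩
    · exact ⟨le_rfl, hB e⟩

variable (N)

/-- Truncate the storage at every source to at most `h`. -/
noncomputable def capStorage (p : FlowPoint V) : FlowPoint V where
  x := p.x
  z := fun e => match e with
    | (none, some i) => min (p.z (none, some i)) N.h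
    | e => p.z e

variable {N}

lemma FlowConstraints.capStorage {p : FlowPoint V} (hp : N.FlowConstraints p) :
    N.FlowConstraints (N.capStorage p) := by
  refine hp.of_eq (fun t ht e he => rfl) (fun e he => rfl) (fun t ht i hi => ?_)
  refine le_min (hp.1 t ht _ (N.none_mem_Estar.2 hi)).2.1 ?_
  simpa using hp.source_le ht (Finset.singleton_subset_iff.2 hi)

lemma coded_cost_capStorage_le (hd : ∀ i ∈ N.S, 0 ≤ N.d i) (p : FlowPoint V) :
    N.coded.cost (N.capStorage p) ≤ N.coded.cost p :=
  add_le_add (N.edgeCost_congr fun _ _ => rfl).le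
    (Finset.sum_le_sum fun i hi => mul_le_mul_of_nonneg_left (min_le_left _ _) (hd i hi))

lemma coded_cost_restrict (p : FlowPoint V) :
    N.coded.cost (N.restrict p) = N.coded.cost p := by
  have h₁ : N.edgeCost (N.restrict p) = N.edgeCost p :=
    N.edgeCost_congr fun e he => if_pos (N.some_mem_Estar.2 he)
  have h₂ : N.storageCost (N.restrict p) = N.storageCost p :=
    Finset.sum_congr rfl fun i hi => by
      rw [show (N.restrict p).z (none, some i) = _ from if_pos (N.none_mem_Estar.2 hi)]
  simp only [coded, h₁, h₂]

lemma exists_isOptimal_coded (hT : N.T.Nonempty) (hd : ∀ i ∈ N.S, 0 ≤ N.d i)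
    (hne : N.coded.feasible.Nonempty) : ∃ p, N.coded.IsOptimal p := by
  refine N.coded.exists_isOptimal_of_isCompact
    (N.isCompact_flowBox.inter_right N.isClosed_flowConstraints)
    (fun k => ⟨k.1, k.2⟩) (fun k hk => hk.2) ?_ (fun p hp => ?_) hne
  · simp only [coded, edgeCost, storageCost]
    fun_prop
  · have hp' : N.FlowConstraints p := hp
    exact ⟨_, ⟨hp'.capStorage.restrict_mem_flowBox hT fun i _ => min_le_right _ _,
      hp'.capStorage.restrict⟩, (coded_cost_restrict _).trans_le (coded_cost_capStorage_le hd p)⟩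

/-! ### From coded points to atom values -/

/-- The conditional entropies `H(X_U | X_{S \ U})` for the polymatroid `W ↦ min h (∑ i ∈ W, y i)`. -/
noncomputable def truncatedCondEntropy (S : Finset V) (h : ℝ) (y : V → ℝ) (U : Finset V) : ℝ :=
  h - min h (∑ i ∈ S \ U, y i)

/-- A nonnegative modular function truncated at `h` is submodular. The hypothesis `hS` makes the
conditional entropy of the empty set vanish, as Möbius inversion requires. -/
lemma elementalInequalities_truncated {S : Finset V} {h : ℝ} {y : V → ℝ}
    (hy : ∀ i ∈ S, 0 ≤ y i) (hS : h ≤ ∑ i ∈ S, y i) :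
    ElementalInequalities S (atomValues (truncatedCondEntropy S h y)) := by
  have h0 : truncatedCondEntropy S h y ∅ = 0 := by simp [truncatedCondEntropy, hS]
  refine ⟨fun i hi => ?_, fun i hi j hj hij K hK => ?_⟩
  · rw [condEntropy_eq_signedMeas_atoms _ (by simpa using hi), signedMeas_atomValues h0]
    exact sub_nonneg.2 (min_le_left _ _)
  · rw [condMutualInfo_eq]
    simp only [signedMeas_sourceSet, signedMeas_atomValues h0, truncatedCondEntropy]
    have hK' : K ⊆ S := hK.trans Finset.sdiff_subset
    have hiK : i ∉ K := fun h => by simpa using hK h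
    have hjK : j ∉ K := fun h => by simpa using hK h
    have e : ∀ W : Finset V, ∀ k ∈ S, k ∉ S \ W →
        ∑ l ∈ S \ (W.erase k), y l = y k + ∑ l ∈ S \ W, y l := by
      intro W k hk hkW
      rw [← Finset.sum_insert hkW]
      congr 1
      ext l
      simp only [Finset.mem_sdiff, Finset.mem_erase, Finset.mem_insert]
      by_cases hl : l = k <;> simp [hl, hk]
    -- With `c` the sum over `K`, the claim becomes submodularity of `min h` at `c`, `y i + c`, `y j
    -- + c` and `y i + (y j + c)`.
    rw [e _ i hi (by simp [hi, hiK]), e _ j hj (by simp [hj, hjK]),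
      e _ i hi (by simp [hi, hiK, hij]), e _ j hj (by simp [hj, hjK])]
    have hi0 := hy i hi
    have hj0 := hy j hj
    generalize ∑ l ∈ S \ (S \ K), y l = c
    rcases min_cases h c with h₁ | h₁ <;> rcases min_cases h (y i + c) with h₂ | h₂ <;>
    rcases min_cases h (y j + c) with h₃ | h₃ <;>
    rcases min_cases h (y i + (y j + c)) with h₄ | h₄ <;> linarith

variable (N) in
/-- Rates equal to the flows out of `s*`, and the atom values of the polymatroid
`W ↦ min h (∑ i ∈ W, z_{s* i})`, after truncating the storage. -/
noncomputable def toAtomFlowPoint (p : FlowPoint V) : AtomFlowPoint V where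
  toFlowPoint := N.capStorage p
  R := fun t i => p.x t (none, some i)
  μ := atomValues (truncatedCondEntropy N.S N.h fun i => min (p.z (none, some i)) N.h)

lemma toAtomFlowPoint_mem_feasible (hT : N.T.Nonempty) {p : FlowPoint V}
    (hp : N.FlowConstraints p) : N.toAtomFlowPoint p ∈ N.atomCoded.feasible := by
  set y : V → ℝ := fun i => min (p.z (none, some i)) N.h with hydef
  have hh := hp.h_nonneg hT
  have hy : ∀ i ∈ N.S, 0 ≤ y i := fun i hi =>
    le_min (hp.z_nonneg hT (N.none_mem_Estar.2 hi)) hh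
  have hxy : ∀ t ∈ N.T, ∀ i ∈ N.S, p.x t (none, some i) ≤ y i := fun t ht i hi =>
    (hp.capStorage.1 t ht _ (N.none_mem_Estar.2 hi)).2.1
  have hS : N.h ≤ ∑ i ∈ N.S, y i := by
    obtain ⟨t, ht⟩ := hT
    rw [← hp.sum_source ht]
    exact Finset.sum_le_sum (hxy t ht)
  have h0 : truncatedCondEntropy N.S N.h y ∅ = 0 := by simp [truncatedCondEntropy, hS]
  have hSh : truncatedCondEntropy N.S N.h y N.S = N.h := by simp [truncatedCondEntropy, hh]
  refine ⟨⟨hp.capStorage, fun _ _ _ _ => le_rfl, fun t ht U hU => ?_, fun i hi => ?_, ?_⟩,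
    elementalInequalities_truncated hy hS⟩
  · change condEntropy N.S (atomValues (truncatedCondEntropy N.S N.h y)) U ≤
      ∑ i ∈ U, p.x t (none, some i)
    -- As the flows sum to `h`, the claim is that the flow into `S \ U` is at most both `h` and the
    -- storage there.
    rw [condEntropy_eq_signedMeas_atoms _ hU, signedMeas_atomValues h0, truncatedCondEntropy,
      sub_le_comm, ← hp.sum_source ht, ← Finset.sum_sdiff hU, add_sub_cancel_right,
      Finset.sum_sdiff hU, hp.sum_source ht]
    exact le_min (hp.source_le ht Finset.sdiff_subset)
      (Finset.sum_le_sum fun i hi => hxy t ht i (Finset.mem_sdiff.1 hi).1)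
  · change y i = entropy N.S (atomValues (truncatedCondEntropy N.S N.h y)) {i}
    -- The cap at `h` is what makes `min h (y i)` equal to `y i`.
    rw [entropy_singleton, signedMeas_atomValues h0, signedMeas_atomValues h0, hSh,
      truncatedCondEntropy, Finset.sdiff_erase_self hi, Finset.sum_singleton,
      min_eq_right (min_le_right _ _)]
    ring
  · change N.h = signedMeas (atomValues (truncatedCondEntropy N.S N.h y)) (atoms N.S)
    rw [signedMeas_atomValues h0, hSh]

lemma toAtomFlowPoint_cost_le (hd : ∀ i ∈ N.S, 0 ≤ N.d i) (p : FlowPoint V) :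
    N.atomCoded.cost (N.toAtomFlowPoint p) ≤ N.coded.cost p :=
  coded_cost_capStorage_le hd p

/-! ### Storage cost by atoms and the gap LP -/

lemma storageCost_eq_atomStorageCost {p : AtomFlowPoint V}
    (hp : ∀ i ∈ N.S, p.z (none, some i) = entropy N.S p.μ {i}) :
    N.storageCost p.toFlowPoint = N.atomStorageCost p.μ := by
  have h : ∀ A ∈ atoms N.S,
      (∑ i ∈ N.S.filter (fun i => A ∈ sourceSet N.S i), N.d i) * p.μ A =
        ∑ i ∈ N.S, if i ∈ A then N.d i * p.μ A else 0 := by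
    intro A hA
    rw [Finset.sum_mul, Finset.sum_filter]
    simp [sourceSet, hA]
  rw [atomStorageCost, Finset.sum_congr rfl h, Finset.sum_comm, storageCost]
  refine Finset.sum_congr rfl fun i hi => ?_
  rw [hp i hi, entropy, unionSet_singleton, sourceSet, signedMeas, Finset.mul_sum,
    Finset.sum_filter]

lemma atomStorageCost_congr {μ ν : Finset V → ℝ} (h : ∀ A ∈ atoms N.S, μ A = ν A) :
    N.atomStorageCost μ = N.atomStorageCost ν :=
  Finset.sum_congr rfl fun A hA => by rw [h A hA]

lemma continuous_atomStorageCost : Continuous N.atomStorageCost := by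
  unfold atomStorageCost
  fun_prop

variable (N) in
/-- The atom values between `0` and `|h|`. -/
def atomBox : Set (Finset V → ℝ) := Set.univ.pi fun _ => Set.Icc 0 |N.h|

variable (N) in
lemma isCompact_atomBox : IsCompact N.atomBox :=
  isCompact_univ_pi fun _ => isCompact_Icc

variable (N) in
/-- The atom values, set to zero away from the atoms. -/
def restrictAtoms (μ : Finset V → ℝ) (A : Finset V) : ℝ := if A ∈ atoms N.S then μ A else 0

lemma restrictAtoms_of_mem (μ : Finset V → ℝ) {A : Finset V} (hA : A ∈ atoms N.S) :
    N.restrictAtoms μ A = μ A := if_pos hA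

lemma restrictAtoms_mem_atomBox {μ : Finset V → ℝ} (h0 : ∀ A ∈ atoms N.S, 0 ≤ μ A)
    (hμ : signedMeas μ (atoms N.S) = N.h) : N.restrictAtoms μ ∈ N.atomBox := by
  intro A _
  simp only [restrictAtoms]
  split_ifs with hA
  · exact ⟨h0 A hA, (le_signedMeas_atoms h0 hA).trans (hμ ▸ le_abs_self _)⟩
  · exact ⟨le_rfl, abs_nonneg _⟩

lemma condEntropy_restrictAtoms (μ : Finset V → ℝ) (U : Finset V) :
    condEntropy N.S (N.restrictAtoms μ) U = condEntropy N.S μ U :=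
  signedMeas_congr (fun _ => restrictAtoms_of_mem μ) Finset.sdiff_subset

lemma exists_isOptimal_gap {μ₁ : Finset V → ℝ} (hne : (N.gap μ₁).feasible.Nonempty) :
    ∃ μ, (N.gap μ₁).IsOptimal μ := by
  have hcl : IsClosed (N.gap μ₁).feasible := by
    simp only [gap, condEntropy, Set.ofPred_and, Set.ofPred_forall]
    refine .inter (isClosed_iInter fun U => isClosed_iInter fun _ => ?_)
      (.inter (isClosed_iInter fun A => isClosed_iInter fun _ => ?_) ?_)
    · exact isClosed_le (by fun_prop) (by fun_prop)
    · exact isClosed_le (by fun_prop) (by fun_prop)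
    · exact isClosed_eq (by fun_prop) (by fun_prop)
  refine (N.gap μ₁).exists_isOptimal_of_isCompact (N.isCompact_atomBox.inter_right hcl) id
    (fun _ hk => hk.2) (continuous_atomStorageCost.sub continuous_const) (fun μ hμ => ?_) hne
  refine ⟨N.restrictAtoms μ, ⟨restrictAtoms_mem_atomBox hμ.2.1 hμ.2.2, fun U hU => ?_,
    fun A hA => ?_, ?_⟩, ?_⟩
  · rw [condEntropy_restrictAtoms]
    exact hμ.1 U hU
  · rw [restrictAtoms_of_mem μ hA]
    exact hμ.2.1 A hA
  · rw [signedMeas_congr (fun _ => restrictAtoms_of_mem μ) le_rfl]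
    exact hμ.2.2
  · exact sub_le_sub_right (atomStorageCost_congr fun _ => restrictAtoms_of_mem μ).le _

/-- All the measure on the atom contained in every `X̃ᵢ` is feasible for the gap problem. -/
lemma gap_feasible_nonempty (hh : 0 ≤ N.h) {μ₁ : Finset V → ℝ}
    (hμ₁ : ElementalInequalities N.S μ₁) (hsum : signedMeas μ₁ (atoms N.S) = N.h) :
    (N.gap μ₁).feasible.Nonempty := by
  refine ⟨fun A => if A = N.S then N.h else 0, fun U hU => ?_, fun A _ => ?_, ?_⟩
  · by_cases hUS : U = N.S
    · subst hUS
      rw [condEntropy_eq_signedMeas_atoms _ le_rfl, condEntropy_eq_signedMeas_atoms _ le_rfl,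
        hsum, signedMeas, Finset.sum_ite_eq']
      split_ifs
      exacts [le_rfl, hh]
    · refine le_trans (le_of_eq ?_) (hμ₁.condEntropy_nonneg hU)
      rw [condEntropy_eq_signedMeas_atoms _ hU, signedMeas, Finset.sum_ite_eq', if_neg]
      exact fun h => hUS (hU.antisymm (mem_atoms.1 h).2)
  · dsimp only
    split_ifs
    exacts [hh, le_rfl]
  · rw [signedMeas, Finset.sum_ite_eq']
    split_ifs with h
    · rfl
    -- Without sources there are no atoms, and `hsum` forces `h = 0`.
    · have hS : N.S = ∅ := by
        by_contra hS
        exact h (mem_atoms.2 ⟨hS, le_rfl⟩)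
      rw [← hsum, hS]
      simp [atoms, signedMeas]

lemma withAtoms_mem_feasible {q : AtomFlowPoint V} (hq : N.AtomConstraints q)
    {μ : Finset V → ℝ} (hμ : μ ∈ (N.gap q.μ).feasible) :
    N.withAtoms q μ ∈ N.subset.feasible := by
  obtain ⟨hflow, hR, hSW, hz, hsum⟩ := hq
  refine ⟨⟨?_, hR, fun t ht U hU => (hμ.1 U hU).trans (hSW t ht U hU), fun i hi => rfl,
    hμ.2.2.symm⟩, hμ.2.1⟩
  refine hflow.of_eq (fun _ _ _ _ => rfl) (fun _ _ => rfl) fun t ht i hi => ?_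
  refine ((hflow.1 t ht _ (N.none_mem_Estar.2 hi)).2.1).trans ?_
  change _ ≤ entropy N.S μ {i}
  -- `H(X_i)` is the total minus the value at `S \ {i}`; the totals agree, so this constraint gives
  -- the new storage at least the old.
  have h := hμ.1 (N.S.erase i) (Finset.erase_subset _ _)
  rw [condEntropy_eq_signedMeas_atoms _ (Finset.erase_subset _ _),
    condEntropy_eq_signedMeas_atoms _ (Finset.erase_subset _ _)] at h
  rw [hz i hi, entropy_singleton, entropy_singleton, hμ.2.2, ← hsum]
  linarith

lemma subset_cost_withAtoms {q : AtomFlowPoint V} (hq : N.AtomConstraints q)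
    (μ : Finset V → ℝ) :
    N.subset.cost (N.withAtoms q μ) = N.atomCoded.cost q + (N.gap q.μ).cost μ := by
  have h := storageCost_eq_atomStorageCost hq.2.2.2.1
  have h' : N.edgeCost (N.withAtoms q μ).toFlowPoint = N.edgeCost q.toFlowPoint :=
    N.edgeCost_congr fun _ _ => rfl
  change N.edgeCost (N.withAtoms q μ).toFlowPoint + N.atomStorageCost μ =
    N.edgeCost q.toFlowPoint + N.storageCost q.toFlowPoint +
      (N.atomStorageCost μ - N.atomStorageCost q.μ)
  rw [h, h']
  ring

/-! ### Optima of the subset problem -/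

/-- A point of the subset problem, with the rates equal to the flows out of `s*`. -/
def ofFlowAtoms (k : ((V → Option V × Option V → ℝ) × (Option V × Option V → ℝ)) ×
    (Finset V → ℝ)) : AtomFlowPoint V where
  x := k.1.1
  z := k.1.2
  R := fun t i => k.1.1 t (none, some i)
  μ := k.2

lemma isClosed_subset_feasible_ofFlowAtoms :
    IsClosed {k | ofFlowAtoms k ∈ N.subset.feasible} := by
  change IsClosed {k : ((V → Option V × Option V → ℝ) × (Option V × Option V → ℝ)) ×
      (Finset V → ℝ) | (N.FlowConstraints ⟨k.1.1, k.1.2⟩ ∧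
    (∀ t ∈ N.T, ∀ i ∈ N.S, k.1.1 t (none, some i) ≤ k.1.1 t (none, some i)) ∧
    (∀ t ∈ N.T, ∀ U ⊆ N.S, signedMeas k.2 (atoms N.S \ unionSet N.S (N.S \ U)) ≤
      ∑ i ∈ U, k.1.1 t (none, some i)) ∧
    (∀ i ∈ N.S, k.1.2 (none, some i) = signedMeas k.2 (unionSet N.S {i})) ∧
    N.h = signedMeas k.2 (atoms N.S)) ∧ ∀ A ∈ atoms N.S, 0 ≤ k.2 A}
  simp only [le_refl, implies_true, true_and, Set.ofPred_and, Set.ofPred_forall]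
  refine .inter (.inter ?_ (.inter ?_ (.inter ?_ ?_))) ?_
  · exact N.isClosed_flowConstraints.preimage continuous_fst
  · refine isClosed_iInter fun t => isClosed_iInter fun _ => isClosed_iInter fun U =>
      isClosed_iInter fun _ => isClosed_le (by fun_prop) (by fun_prop)
  · exact isClosed_iInter fun i => isClosed_iInter fun _ =>
      isClosed_eq (by fun_prop) (by fun_prop)
  · exact isClosed_eq (by fun_prop) (by fun_prop)
  · exact isClosed_iInter fun A => isClosed_iInter fun _ =>
      isClosed_le (by fun_prop) (by fun_prop)

/-- Raising the rates to the flows out of `s*` keeps feasibility and cost, so only flows, capacities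
and atom values need a compact range. -/
lemma exists_isOptimal_subset (hT : N.T.Nonempty) (hne : N.subset.feasible.Nonempty) :
    ∃ r, N.subset.IsOptimal r := by
  refine N.subset.exists_isOptimal_of_isCompact
    ((N.isCompact_flowBox.prod N.isCompact_atomBox).inter_right
      isClosed_subset_feasible_ofFlowAtoms)
    ofFlowAtoms (fun k hk => hk.2) ?_ (fun p hp => ?_) hne
  · have := continuous_atomStorageCost (N := N)
    simp only [subset, edgeCost, ofFlowAtoms]
    fun_prop
  obtain ⟨⟨hflow, hR, hSW, hz, hsum⟩, h0⟩ := hp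
  have hμ : ∀ A ∈ atoms N.S, N.restrictAtoms p.μ A = p.μ A := fun _ => restrictAtoms_of_mem _
  refine ⟨(((N.restrict p.toFlowPoint).x, (N.restrict p.toFlowPoint).z), N.restrictAtoms p.μ),
    ⟨⟨hflow.restrict_mem_flowBox hT fun i hi => ?_, restrictAtoms_mem_atomBox h0 hsum.symm⟩,
      ⟨hflow.restrict, fun _ _ _ _ => le_rfl, fun t ht U hU => ?_, fun i hi => ?_, ?_⟩,
      fun A hA => ?_⟩, le_of_eq ?_⟩
  -- Nonnegative atoms give `H(X_i) ≤ h`, so no capping of storage is needed here.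
  · rw [hz i hi, hsum]
    exact signedMeas_mono h0 (unionSet_subset _ _)
  · refine (condEntropy_restrictAtoms p.μ U).trans_le ((hSW t ht U hU).trans ?_)
    refine Finset.sum_le_sum fun i hi => (hR t ht i (hU hi)).trans (le_of_eq ?_)
    exact (if_pos ⟨ht, N.none_mem_Estar.2 (hU hi)⟩).symm
  · refine (if_pos (N.none_mem_Estar.2 hi)).trans ((hz i hi).trans ?_)
    exact (signedMeas_congr hμ (unionSet_subset _ _)).symm
  · exact hsum.trans (signedMeas_congr hμ le_rfl).symm
  · exact (h0 A hA).trans_eq (hμ A hA).symm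
  · exact congrArg₂ (· + ·) (N.edgeCost_congr fun e he => if_pos (N.some_mem_Estar.2 he))
      (atomStorageCost_congr hμ)

end MulticastInstance

theorem mainTheorem5 {V : Type*} [Fintype V] [DecidableEq V] (N : MulticastInstance V)
    (hT : N.T.Nonempty) (hd : ∀ i ∈ N.S, 0 ≤ N.d i) :
    -- the two coded problems have the same optimum, attained as soon as there is a feasible point
    (N.atomCoded.value = N.coded.value ∧
      (N.coded.feasible.Nonempty →
        ∃ p q, N.coded.IsOptimal p ∧ N.atomCoded.IsOptimal q ∧
          N.coded.cost p = N.atomCoded.cost q)) ∧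
    -- for every optimal solution of the atom version:
    ∀ q, N.atomCoded.IsOptimal q →
      -- the gap LP has an optimal solution,
      (∃ μ, (N.gap q.μ).IsOptimal μ) ∧
      -- its feasible points give feasible subset solutions with the same flows,
      (∀ μ ∈ (N.gap q.μ).feasible,
        N.withAtoms q μ ∈ N.subset.feasible ∧
        N.subset.cost (N.withAtoms q μ) = N.atomCoded.cost q + (N.gap q.μ).cost μ) ∧
      -- and its optimal value bounds the gap between the subset and the coded optimum.
      (∃ r, N.subset.IsOptimal r) ∧
      ∀ p r μ, N.coded.IsOptimal p → N.subset.IsOptimal r → (N.gap q.μ).IsOptimal μ →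
        N.subset.cost r - N.coded.cost p ≤ (N.gap q.μ).cost μ := by
  have hto : ∀ p ∈ N.coded.feasible, ∃ q ∈ N.atomCoded.feasible,
      N.atomCoded.cost q ≤ N.coded.cost p := fun p hp =>
    ⟨_, MulticastInstance.toAtomFlowPoint_mem_feasible hT hp, N.toAtomFlowPoint_cost_le hd p⟩
  have hof : ∀ q ∈ N.atomCoded.feasible, ∃ p ∈ N.coded.feasible,
      N.coded.cost p ≤ N.atomCoded.cost q := fun q hq => ⟨q.toFlowPoint, hq.1.1, le_rfl⟩
  refine ⟨⟨le_antisymm (MinProblem.value_le_value hto) (MinProblem.value_le_value hof),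
    fun hne => ?_⟩, fun q hq => ?_⟩
  · obtain ⟨p, hp⟩ := MulticastInstance.exists_isOptimal_coded hT hd hne
    obtain ⟨q, hq, hqp⟩ := hto p hp.1
    have hpq : N.coded.cost p ≤ N.atomCoded.cost q := hp.2 q.toFlowPoint hq.1.1
    exact ⟨p, q, hp, ⟨hq, fun r hr => hqp.trans (hp.2 r.toFlowPoint hr.1.1)⟩,
      le_antisymm hpq hqp⟩
  · have hsum := hq.1.1.2.2.2.2.symm
    obtain ⟨μ₀, hμ₀⟩ := MulticastInstance.gap_feasible_nonempty (hq.1.1.1.h_nonneg hT) hq.1.2 hsum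
    have hfeas : ∀ μ ∈ (N.gap q.μ).feasible, N.withAtoms q μ ∈ N.subset.feasible :=
      fun μ hμ => MulticastInstance.withAtoms_mem_feasible hq.1.1 hμ
    refine ⟨MulticastInstance.exists_isOptimal_gap ⟨μ₀, hμ₀⟩,
      fun μ hμ => ⟨hfeas μ hμ, MulticastInstance.subset_cost_withAtoms hq.1.1 μ⟩,
      MulticastInstance.exists_isOptimal_subset hT ⟨_, hfeas μ₀ hμ₀⟩, fun p r μ hp hr hμ => ?_⟩
    -- The cost of `q` is at most that of `p`, and that of `r` at most that of `q` plus the gap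
    -- objective at `μ`.
    obtain ⟨q', hq', hqp⟩ := hto p hp.1
    have h₁ := (hq.2 q' hq').trans hqp
    have h₂ := hr.2 _ (hfeas μ hμ.1)
    rw [MulticastInstance.subset_cost_withAtoms hq.1.1 μ] at h₂
    linarith
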